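/- Let $X$ be a finite set and let $F(X)$ be the free lattice over $X$, whose elements are represented by the terms built from $X$ with the binary operations $\vee$ and $\wedge$. Let $R$ be a finite set of pairs of such terms, and let $\rho$ be the congruence of $F(X)$ generated by the pairs of elements of $F(X)$ that the pairs in $R$ represent. A lattice homomorphism $g\colon A\to D$ is called lower bounded if for every $d\in D$ the set $\{x\in A : g(x)\ge d\}$ is empty or has a least element, and upper bounded if for every $d\in D$ the set $\{x\in A : g(x)\le d\}$ is empty or has a greatest element. A lattice $D$ is called bounded if there are finite sets $Y,Z$, a lower bounded epimorphism $F(Y)\to D$ and an upper bounded epimorphism $F(Z)\to D$. Then the following are equivalent: 1. The lattice $F(X)/\rho$ is bounded. 2. $\rho$ is finitely generated as a sublattice of $F(X)\times F(X)$. 3. For every $u$ that is an element of $X$ or a subterm of a term occurring in $R$, the congruence class $u/\rho=\{w\in F(X) : (u,w)\in\rho\}$ has a least and a greatest element. -/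

import Mathlib

/-- Lattice terms over a set `X` of variables. -/
inductive LatTerm (X : Type*) where
  | var : X → LatTerm X
  | join : LatTerm X → LatTerm X → LatTerm X
  | meet : LatTerm X → LatTerm X → LatTerm X

namespace LatTerm

/-- The set of subterms of a term (the term itself included). -/
def subterms {X : Type*} : LatTerm X → Set (LatTerm X)
  | var x => {var x}
  | join s t => insert (join s t) (subterms s ∪ subterms t)
  | meet s t => insert (meet s t) (subterms s ∪ subterms t)

/-- `Le s t`: the inequality `s ≤ t` is derivable from the axioms of lattices
(preorder, least upper bounds, greatest lower bounds). -/
inductive Le {X : Type*} : LatTerm X → LatTerm X → Prop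
  | refl (t : LatTerm X) : Le t t
  | trans {s t u : LatTerm X} : Le s t → Le t u → Le s u
  | left_le_join (s t : LatTerm X) : Le s (join s t)
  | right_le_join (s t : LatTerm X) : Le t (join s t)
  | join_le {s t u : LatTerm X} : Le s u → Le t u → Le (join s t) u
  | meet_le_left (s t : LatTerm X) : Le (meet s t) s
  | meet_le_right (s t : LatTerm X) : Le (meet s t) t
  | le_meet {s t u : LatTerm X} : Le s t → Le s u → Le s (meet t u)

instance {X : Type*} : Preorder (LatTerm X) where
  le := Le
  le_refl := Le.refl
  le_trans _ _ _ := Le.trans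

/-- The value of a term in a lattice. -/
def eval {X L : Type*} [Lattice L] (v : X → L) : LatTerm X → L
  | var x => v x
  | join s t => eval v s ⊔ eval v t
  | meet s t => eval v s ⊓ eval v t

theorem eval_mono {X L : Type*} [Lattice L] (v : X → L) {s t : LatTerm X} (h : s ≤ t) :
    eval v s ≤ eval v t := by
  induction (h : Le s t) with
  | refl => exact le_rfl
  | trans h₁ h₂ ih₁ ih₂ => exact ih₁.trans ih₂
  | left_le_join => exact le_sup_left
  | right_le_join => exact le_sup_right
  | join_le h₁ h₂ ih₁ ih₂ => exact sup_le ih₁ ih₂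
  | meet_le_left => exact inf_le_left
  | meet_le_right => exact inf_le_right
  | le_meet h₁ h₂ ih₁ ih₂ => exact le_inf ih₁ ih₂

end LatTerm

/-- The free lattice over `X`: lattice terms modulo the equations that hold in all lattices. -/
def FreeLattice (X : Type*) : Type _ := Antisymmetrization (LatTerm X) (· ≤ ·)

namespace FreeLattice

instance {X : Type*} : PartialOrder (FreeLattice X) :=
  inferInstanceAs (PartialOrder (Antisymmetrization (LatTerm X) (· ≤ ·)))

/-- The element of the free lattice represented by a term. -/
def mk {X : Type*} (t : LatTerm X) : FreeLattice X := toAntisymmetrization (· ≤ ·) t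

theorem mk_le_mk {X : Type*} {s t : LatTerm X} : mk s ≤ mk t ↔ s ≤ t := Iff.rfl

theorem mk_surjective {X : Type*} : Function.Surjective (mk : LatTerm X → FreeLattice X) :=
  Quotient.mk_surjective

theorem mk_eq_mk {X : Type*} {s t : LatTerm X} : mk s = mk t ↔ s ≤ t ∧ t ≤ s := by
  rw [le_antisymm_iff, mk_le_mk, mk_le_mk]

instance {X : Type*} : Lattice (FreeLattice X) where
  sup := Quotient.map₂ LatTerm.join fun _ _ h₁ _ _ h₂ =>
    ⟨.join_le (.trans h₁.1 (.left_le_join _ _)) (.trans h₂.1 (.right_le_join _ _)),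
      .join_le (.trans h₁.2 (.left_le_join _ _)) (.trans h₂.2 (.right_le_join _ _))⟩
  inf := Quotient.map₂ LatTerm.meet fun _ _ h₁ _ _ h₂ =>
    ⟨.le_meet (.trans (.meet_le_left _ _) h₁.1) (.trans (.meet_le_right _ _) h₂.1),
      .le_meet (.trans (.meet_le_left _ _) h₁.2) (.trans (.meet_le_right _ _) h₂.2)⟩
  le_sup_left := by rintro ⟨s⟩ ⟨t⟩; exact LatTerm.Le.left_le_join s t
  le_sup_right := by rintro ⟨s⟩ ⟨t⟩; exact LatTerm.Le.right_le_join s t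
  sup_le := by rintro ⟨s⟩ ⟨t⟩ ⟨u⟩ h₁ h₂; exact LatTerm.Le.join_le h₁ h₂
  inf_le_left := by rintro ⟨s⟩ ⟨t⟩; exact LatTerm.Le.meet_le_left s t
  inf_le_right := by rintro ⟨s⟩ ⟨t⟩; exact LatTerm.Le.meet_le_right s t
  le_inf := by rintro ⟨s⟩ ⟨t⟩ ⟨u⟩ h₁ h₂; exact LatTerm.Le.le_meet h₁ h₂

theorem mk_join {X : Type*} (s t : LatTerm X) : mk (.join s t) = mk s ⊔ mk t := rfl

theorem mk_meet {X : Type*} (s t : LatTerm X) : mk (.meet s t) = mk s ⊓ mk t := rfl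

/-- The universal property: a map from `X` to a lattice extends uniquely to a lattice
homomorphism on the free lattice over `X`. -/
theorem existsUnique_hom {X L : Type*} [Lattice L] (v : X → L) :
    ∃! f : LatticeHom (FreeLattice X) L, ∀ x, f (mk (.var x)) = v x := by
  refine ⟨{ toFun := Quotient.lift (LatTerm.eval v) fun _ _ h =>
              le_antisymm (LatTerm.eval_mono v h.1) (LatTerm.eval_mono v h.2)
            map_sup' := by rintro ⟨s⟩ ⟨t⟩; rfl
            map_inf' := by rintro ⟨s⟩ ⟨t⟩; rfl }, fun x => rfl, ?_⟩
  intro f hf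
  ext a
  obtain ⟨t, rfl⟩ := mk_surjective a
  induction t with
  | var x => exact hf x
  | join s t ihs iht => rw [mk_join, map_sup, map_sup, ihs, iht]
  | meet s t ihs iht => rw [mk_meet, map_inf, map_inf, ihs, iht]

end FreeLattice

namespace LatticeCon

/-- The quotient of a lattice by a congruence. -/
def Quot {A : Type*} [Lattice A] (ρ : LatticeCon A) : Type _ := Quotient ρ.toSetoid

instance {A : Type*} [Lattice A] (ρ : LatticeCon A) : Max ρ.Quot :=
  ⟨Quotient.map₂ (· ⊔ ·) fun _ _ h₁ _ _ h₂ => ρ.sup h₁ h₂⟩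

instance {A : Type*} [Lattice A] (ρ : LatticeCon A) : Min ρ.Quot :=
  ⟨Quotient.map₂ (· ⊓ ·) fun _ _ h₁ _ _ h₂ => ρ.inf h₁ h₂⟩

/-- The class of an element in the quotient. -/
def toQuot {A : Type*} [Lattice A] (ρ : LatticeCon A) (a : A) : ρ.Quot := Quotient.mk ρ.toSetoid a

theorem toQuot_surjective {A : Type*} [Lattice A] (ρ : LatticeCon A) :
    Function.Surjective ρ.toQuot := Quotient.mk_surjective

theorem toQuot_sup {A : Type*} [Lattice A] (ρ : LatticeCon A) (a b : A) :
    ρ.toQuot (a ⊔ b) = ρ.toQuot a ⊔ ρ.toQuot b := rfl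

theorem toQuot_inf {A : Type*} [Lattice A] (ρ : LatticeCon A) (a b : A) :
    ρ.toQuot (a ⊓ b) = ρ.toQuot a ⊓ ρ.toQuot b := rfl

/-- The quotient lattice, with the operations induced on classes. -/
instance {A : Type*} [Lattice A] (ρ : LatticeCon A) : Lattice ρ.Quot :=
  Lattice.mk'
    (by rintro ⟨a⟩ ⟨b⟩; exact congrArg ρ.toQuot (sup_comm a b))
    (by rintro ⟨a⟩ ⟨b⟩ ⟨c⟩; exact congrArg ρ.toQuot (sup_assoc a b c))
    (by rintro ⟨a⟩ ⟨b⟩; exact congrArg ρ.toQuot (inf_comm a b))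
    (by rintro ⟨a⟩ ⟨b⟩ ⟨c⟩; exact congrArg ρ.toQuot (inf_assoc a b c))
    (by rintro ⟨a⟩ ⟨b⟩; exact congrArg ρ.toQuot (sup_inf_self (a := a) (b := b)))
    (by rintro ⟨a⟩ ⟨b⟩; exact congrArg ρ.toQuot (inf_sup_self (a := a) (b := b)))

/-- The congruence generated by a set of pairs: the intersection of all congruences
containing it. -/
def generate {A : Type*} [Lattice A] (R : Set (A × A)) : LatticeCon A where
  r a b := ∀ c : LatticeCon A, (∀ p ∈ R, c.r p.1 p.2) → c.r a b
  iseqv :=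
    { refl := fun a c _ => c.iseqv.refl a
      symm := fun h c hc => c.iseqv.symm (h c hc)
      trans := fun h₁ h₂ c hc => c.iseqv.trans (h₁ c hc) (h₂ c hc) }
  inf h₁ h₂ c hc := c.inf (h₁ c hc) (h₂ c hc)
  sup h₁ h₂ c hc := c.sup (h₁ c hc) (h₂ c hc)

end LatticeCon

/-- A homomorphism `g : A → D` is lower bounded if for every `d` the set `{x | d ≤ g x}` is
empty or has a least element. -/
def LatticeHom.IsLowerBounded {A D : Type*} [Lattice A] [Lattice D] (g : LatticeHom A D) : Prop :=
  ∀ d : D, {x : A | d ≤ g x} = ∅ ∨ ∃ a, IsLeast {x : A | d ≤ g x} a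

/-- A homomorphism `g : A → D` is upper bounded if for every `d` the set `{x | g x ≤ d}` is
empty or has a greatest element. -/
def LatticeHom.IsUpperBounded {A D : Type*} [Lattice A] [Lattice D] (g : LatticeHom A D) : Prop :=
  ∀ d : D, {x : A | g x ≤ d} = ∅ ∨ ∃ a, IsGreatest {x : A | g x ≤ d} a

/-- A lattice is lower bounded (in the sense of McKenzie) if it is the image of a finitely
generated free lattice under a lower bounded epimorphism. -/
def IsLowerBoundedLattice (D : Type*) [Lattice D] : Prop :=
  ∃ (n : ℕ) (f : LatticeHom (FreeLattice (Fin n)) D), Function.Surjective f ∧ f.IsLowerBounded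

/-- A lattice is upper bounded if it is the image of a finitely generated free lattice under
an upper bounded epimorphism. -/
def IsUpperBoundedLattice (D : Type*) [Lattice D] : Prop :=
  ∃ (n : ℕ) (f : LatticeHom (FreeLattice (Fin n)) D), Function.Surjective f ∧ f.IsUpperBounded

/-- A lattice is bounded (in the sense of McKenzie) if it is both lower and upper bounded. -/
def IsBoundedLattice (D : Type*) [Lattice D] : Prop :=
  IsLowerBoundedLattice D ∧ IsUpperBoundedLattice D

/-! The finite presentation enters only through Dean's condition: in `D = F(X)/ρ`, an inequality `a
⊓ b ≤ c ⊔ d` either holds for one of Whitman's four trivial reasons or passes through one of the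
finitely many images `P` of relation sides. Otherwise, doubling the interval `[a ⊓ b, c ⊔ d]` would
preserve all relations but destroy an inequality that they imply (`deanCondition_of_presentation`).

For 3 → 1, the elements at which the quotient map is lower bounded are closed under joins always,
and under meets by Dean's condition (`isLowerBounded_of_deanCondition`); upper bounds follow by
duality. For 1 → 2, let `β d` and `α d` be the least and greatest preimages of `d`. Finitely many
pairs `(β p, α p)` and `(x, α (g x))` generate all `(w, α (g w))`; adding the swapped pairs gives
`(x, α) ⊓ (α, y) = (x, y)` whenever `α` is the common top of the classes of `x` and `y`. For 2 → 1,
a finitely generated kernel projects to the free lattice by a bounded map, and its extremal pairs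
give the bounds for `g`. Lifting between free covers shows that condition 1 concerns the quotient
map alone (`isBoundedLattice_iff`). -/

open OrderDual

/-! ### Lower boundedness from Dean's condition -/

section Bounded

variable {A D : Type*} [Lattice A] [Lattice D]

/-- The smallest subset containing `X` and closed under both operations is everything. -/
def LatticeGenerates (X : Set A) : Prop :=
  ∀ S : Set A, X ⊆ S → (∀ a ∈ S, ∀ b ∈ S, a ⊔ b ∈ S) → (∀ a ∈ S, ∀ b ∈ S, a ⊓ b ∈ S) →
    ∀ a, a ∈ S

/-- Dean's weakening of Whitman's condition, relative to a set `P` of exceptional elements. -/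
def DeanCondition (P : Set D) : Prop :=
  ∀ a b c d : D, a ⊓ b ≤ c ⊔ d →
    a ≤ c ⊔ d ∨ b ≤ c ⊔ d ∨ a ⊓ b ≤ c ∨ a ⊓ b ≤ d ∨ ∃ p ∈ P, a ⊓ b ≤ p ∧ p ≤ c ⊔ d

/-- The condition of lower boundedness of `g` at a single element `d`. -/
def LatticeHom.IsLowerBoundedAt (g : LatticeHom A D) (d : D) : Prop :=
  {x : A | d ≤ g x} = ∅ ∨ ∃ a, IsLeast {x : A | d ≤ g x} a

theorem LatticeGenerates.dual {X : Set A} (h : LatticeGenerates X) :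
    LatticeGenerates (ofDual ⁻¹' X : Set Aᵒᵈ) :=
  fun S h₁ h₂ h₃ a => h (toDual ⁻¹' S) h₁ h₃ h₂ (ofDual a)

theorem DeanCondition.mono {P Q : Set D} (h : DeanCondition P) (hPQ : P ⊆ Q) :
    DeanCondition Q := by
  intro a b c d habcd
  rcases h a b c d habcd with h | h | h | h | ⟨p, hp, h⟩
  · exact .inl h
  · exact .inr (.inl h)
  · exact .inr (.inr (.inl h))
  · exact .inr (.inr (.inr (.inl h)))
  · exact .inr (.inr (.inr (.inr ⟨p, hPQ hp, h⟩)))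

theorem DeanCondition.dual {P : Set D} (h : DeanCondition P) :
    DeanCondition (ofDual ⁻¹' P : Set Dᵒᵈ) := by
  intro a b c d habcd
  rcases h (ofDual c) (ofDual d) (ofDual a) (ofDual b) habcd with h | h | h | h | ⟨p, hp, h₁, h₂⟩
  · exact .inr (.inr (.inl h))
  · exact .inr (.inr (.inr (.inl h)))
  · exact .inl h
  · exact .inr (.inl h)
  · exact .inr (.inr (.inr (.inr ⟨toDual p, hp, h₂, h₁⟩)))

theorem LatticeHom.IsUpperBounded.of_dual {g : LatticeHom A D}
    (h : (LatticeHom.dual g).IsLowerBounded) : g.IsUpperBounded := h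

namespace LatticeHom

variable (g : LatticeHom A D)

/-- If every covering `d ≤ s ⊔ t` is trivial or is witnessed by one of finitely many elements above
`d` where `g` is lower bounded, then `g` is lower bounded at `d`. -/
theorem isLowerBoundedAt_of_cover {X : Set A} (hX : LatticeGenerates X) (hfin : X.Finite)
    {d : D} {N : Set D} (hN : N.Finite) (hdN : ∀ n ∈ N, d ≤ n)
    (hlow : ∀ n ∈ N, g.IsLowerBoundedAt n)
    (hcov : ∀ s t : D, d ≤ s ⊔ t → d ≤ s ∨ d ≤ t ∨ ∃ n ∈ N, n ≤ s ⊔ t) :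
    g.IsLowerBoundedAt d := by
  -- The meet of `Q` will be the least element. Since `A` need not have a top, nonemptiness of `Q`
  -- is carried through the induction: an empty `Q` means an empty preimage.
  set Q : Set A := {x ∈ X | d ≤ g x} ∪ ⋃ n ∈ N, {a | IsLeast {x : A | n ≤ g x} a}
  have hQfin : Q.Finite := by
    refine (hfin.subset (Set.sep_subset _ _)).union (hN.biUnion fun n _ => ?_)
    exact Set.Subsingleton.finite fun a ha b hb => ha.unique hb
  have hdQ : ∀ q ∈ Q, d ≤ g q := by
    rintro q (hq | hq)
    · exact hq.2
    · obtain ⟨n, hn, hq⟩ := Set.mem_iUnion₂.1 hq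
      exact (hdN n hn).trans hq.1
  have key : ∀ w : A, d ≤ g w → Q.Nonempty ∧ ∀ l ∈ lowerBounds Q, l ≤ w := by
    refine hX {w | d ≤ g w → Q.Nonempty ∧ ∀ l ∈ lowerBounds Q, l ≤ w} ?_ ?_ ?_
    · intro x hx hdx
      have : x ∈ Q := .inl ⟨hx, hdx⟩
      exact ⟨⟨x, this⟩, fun l hl => hl this⟩
    · intro s hs t ht hst
      rw [map_sup] at hst
      rcases hcov _ _ hst with h | h | ⟨n, hn, h⟩
      · exact ⟨(hs h).1, fun l hl => ((hs h).2 l hl).trans le_sup_left⟩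
      · exact ⟨(ht h).1, fun l hl => ((ht h).2 l hl).trans le_sup_right⟩
      · have hmem : s ⊔ t ∈ {x : A | n ≤ g x} := by simpa only [Set.mem_ofPred_eq, map_sup] using h
        rcases hlow n hn with he | ⟨a, ha⟩
        · exact absurd hmem (he ▸ Set.notMem_empty _)
        · have haQ : a ∈ Q := .inr (Set.mem_iUnion₂.2 ⟨n, hn, ha⟩)
          exact ⟨⟨a, haQ⟩, fun l hl => (hl haQ).trans (ha.2 hmem)⟩
    · intro s hs t ht hst
      rw [map_inf, le_inf_iff] at hst
      exact ⟨(hs hst.1).1, fun l hl => le_inf ((hs hst.1).2 l hl) ((ht hst.2).2 l hl)⟩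
  by_cases hne : Q.Nonempty
  · right
    have hne' : hQfin.toFinset.Nonempty := hQfin.toFinset_nonempty.2 hne
    refine ⟨hQfin.toFinset.inf' hne' id, ?_, fun w hw => (key w hw).2 _ fun q hq => ?_⟩
    · rw [Set.mem_ofPred_eq, map_finset_inf']
      exact Finset.le_inf' _ _ fun q hq => hdQ q (hQfin.mem_toFinset.1 hq)
    · exact Finset.inf'_le id (hQfin.mem_toFinset.2 hq)
  · exact .inl (Set.eq_empty_of_forall_notMem fun w hw => hne (key w hw).1)

theorem IsLowerBoundedAt.sup {g : LatticeHom A D} {d e : D} (hd : g.IsLowerBoundedAt d)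
    (he : g.IsLowerBoundedAt e) : g.IsLowerBoundedAt (d ⊔ e) := by
  have hset : {x : A | d ⊔ e ≤ g x} = {x | d ≤ g x} ∩ {x | e ≤ g x} := by
    ext x; exact sup_le_iff
  rw [LatticeHom.IsLowerBoundedAt, hset]
  rcases hd with hd | ⟨a, ha⟩
  · left; rw [hd, Set.empty_inter]
  rcases he with he | ⟨b, hb⟩
  · left; rw [he, Set.inter_empty]
  refine .inr ⟨a ⊔ b, ⟨?_, ?_⟩, fun w hw => sup_le (ha.2 hw.1) (hb.2 hw.2)⟩
  · exact (show d ≤ g a from ha.1).trans (OrderHomClass.mono g le_sup_left)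
  · exact (show e ≤ g b from hb.1).trans (OrderHomClass.mono g le_sup_right)

theorem isLowerBounded_of_deanCondition {X : Set A} (hX : LatticeGenerates X) (hfin : X.Finite)
    {Y P : Set D} (hY : LatticeGenerates Y) (hP : P.Finite) (hdean : DeanCondition P)
    (hlowP : ∀ p ∈ P, g.IsLowerBoundedAt p) (hlowY : ∀ y ∈ Y, g.IsLowerBoundedAt y) :
    g.IsLowerBounded := by
  refine hY {d | g.IsLowerBoundedAt d} hlowY (fun d hd e he => hd.sup he) ?_
  intro a ha b hb
  -- The witnesses are those Dean's condition offers for `a ⊓ b`: the two factors and the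
  -- exceptional elements above it.
  refine g.isLowerBoundedAt_of_cover hX hfin (N := {a, b} ∪ {p ∈ P | a ⊓ b ≤ p})
    ((Set.toFinite _).union (hP.subset (Set.sep_subset _ _))) ?_ ?_ ?_
  · rintro n ((rfl | rfl) | hn)
    exacts [inf_le_left, inf_le_right, hn.2]
  · rintro n ((rfl | rfl) | hn)
    exacts [ha, hb, hlowP n hn.1]
  · intro s t hst
    rcases hdean a b s t hst with h | h | h | h | ⟨p, hp, h₁, h₂⟩
    · exact .inr (.inr ⟨a, .inl (.inl rfl), h⟩)
    · exact .inr (.inr ⟨b, .inl (.inr rfl), h⟩)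
    · exact .inl h
    · exact .inr (.inl h)
    · exact .inr (.inr ⟨p, .inr ⟨hp, h₁⟩, h₂⟩)

/-- With join-prime generators no covering of a generator is nontrivial, and Whitman's condition
then handles meets. -/
theorem isLowerBounded_of_supPrime {X : Set A} (hX : LatticeGenerates X) (hfin : X.Finite)
    {Y : Set D} (hY : LatticeGenerates Y) (hdean : DeanCondition (∅ : Set D))
    (hprime : ∀ y ∈ Y, ∀ s t, y ≤ s ⊔ t → y ≤ s ∨ y ≤ t) : g.IsLowerBounded :=
  g.isLowerBounded_of_deanCondition hX hfin hY Set.finite_empty hdean (fun _ h => h.elim)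
    fun y hy => g.isLowerBoundedAt_of_cover hX hfin Set.finite_empty (fun _ h => h.elim)
      (fun _ h => h.elim) fun s t hst => (hprime y hy s t hst).imp_right .inl

/-! ### Generating the kernel of a bounded epimorphism -/

variable {g}

theorem IsLowerBounded.exists_isLeast (h : g.IsLowerBounded) {d : D} {x : A} (hx : d ≤ g x) :
    ∃ a, IsLeast {x : A | d ≤ g x} a :=
  (h d).resolve_left fun he => (he ▸ hx : x ∈ (∅ : Set A))

theorem IsUpperBounded.exists_isGreatest (h : g.IsUpperBounded) {d : D} {x : A} (hx : g x ≤ d) :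
    ∃ a, IsGreatest {x : A | g x ≤ d} a :=
  (h d).resolve_left fun he => (he ▸ hx : x ∈ (∅ : Set A))

/-- The relation `K` relates the least preimage of `d` to its greatest one. -/
def RelatesBounds (g : LatticeHom A D) (K : A → A → Prop) (d : D) : Prop :=
  ∃ b a, IsLeast {x : A | d ≤ g x} b ∧ IsGreatest {x : A | g x ≤ d} a ∧ K b a

/-- Under Dean's condition the greatest preimage of a join is a join of finitely many known ones. -/
theorem RelatesBounds.sup {X : Set A} (hX : LatticeGenerates X)
    {P : Set D} (hP : P.Finite) (hdean : DeanCondition P) (hXP : ∀ x ∈ X, g x ∈ P)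
    {K : A → A → Prop}
    (hK : ∀ a b c d, K a b → K c d → K (a ⊔ c) (b ⊔ d)) (hKP : ∀ p ∈ P, g.RelatesBounds K p)
    {d₁ d₂ : D} (h₁ : g.RelatesBounds K d₁) (h₂ : g.RelatesBounds K d₂) :
    g.RelatesBounds K (d₁ ⊔ d₂) := by
  obtain ⟨b₁, a₁, hb₁, ha₁, hK₁⟩ := h₁
  obtain ⟨b₂, a₂, hb₂, ha₂, hK₂⟩ := h₂
  have hd₁ : d₁ ≤ g b₁ := hb₁.1
  have hd₂ : d₂ ≤ g b₂ := hb₂.1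
  have he₁ : g a₁ ≤ d₁ := ha₁.1
  have he₂ : g a₂ ≤ d₂ := ha₂.1
  have hb : IsLeast {x : A | d₁ ⊔ d₂ ≤ g x} (b₁ ⊔ b₂) := by
    refine ⟨?_, fun w hw => sup_le (hb₁.2 (le_sup_left.trans hw)) (hb₂.2 (le_sup_right.trans hw))⟩
    rw [Set.mem_ofPred_eq, map_sup]
    exact sup_le_sup hd₁ hd₂
  have ha₁₂ : g (a₁ ⊔ a₂) ≤ d₁ ⊔ d₂ := by
    rw [map_sup]; exact sup_le_sup he₁ he₂
  -- The greatest preimage will be `a₁ ⊔ a₂` joined with the greatest preimages of all `p ∈ P` below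
  -- `d₁ ⊔ d₂`. Joining in a pair `(b', a')` leaves the left entry fixed because `b' ≤ b₁ ⊔ b₂`.
  have key : ∀ N : Set D, N.Finite → N ⊆ P → (∀ p ∈ N, p ≤ d₁ ⊔ d₂) →
      ∃ a, K (b₁ ⊔ b₂) a ∧ g a ≤ d₁ ⊔ d₂ ∧ a₁ ⊔ a₂ ≤ a ∧ ∀ p ∈ N, ∀ w, g w ≤ p → w ≤ a := by
    intro N hN
    induction N, hN using Set.Finite.induction_on with
    | empty => exact fun _ _ => ⟨a₁ ⊔ a₂, hK _ _ _ _ hK₁ hK₂, ha₁₂, le_rfl, fun _ h => h.elim⟩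
    | @insert p N _ _ ih =>
      intro hNP hNd
      obtain ⟨a, hKa, hga, hle, hN⟩ := ih ((Set.subset_insert _ _).trans hNP)
        fun q hq => hNd q (.inr hq)
      obtain ⟨b', a', hb', ha', hK'⟩ := hKP p (hNP (.inl rfl))
      have hpd : p ≤ d₁ ⊔ d₂ := hNd p (.inl rfl)
      have hb'b : b' ≤ b₁ ⊔ b₂ := hb'.2 (hpd.trans hb.1)
      refine ⟨a ⊔ a', ?_, ?_, hle.trans le_sup_left, ?_⟩
      · have := hK _ _ _ _ hKa hK'
        rwa [sup_eq_left.2 hb'b] at this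
      · rw [map_sup]
        exact sup_le hga ((show g a' ≤ p from ha'.1).trans hpd)
      · rintro q (rfl | hq) w hw
        · exact (ha'.2 hw).trans le_sup_right
        · exact (hN q hq w hw).trans le_sup_left
  obtain ⟨a, hKa, hga, hle, hN⟩ := key {p ∈ P | p ≤ d₁ ⊔ d₂} (hP.subset (Set.sep_subset _ _))
    (Set.sep_subset _ _) fun p hp => hp.2
  refine ⟨b₁ ⊔ b₂, a, hb, ⟨hga, ?_⟩, hKa⟩
  refine hX {w | g w ≤ d₁ ⊔ d₂ → w ≤ a} ?_ ?_ ?_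
  · exact fun x hx hgx => hN (g x) ⟨hXP x hx, hgx⟩ x le_rfl
  · intro s hs t ht hst
    rw [map_sup, sup_le_iff] at hst
    exact sup_le (hs hst.1) (ht hst.2)
  · intro s hs t ht hst
    rw [map_inf] at hst
    rcases hdean _ _ _ _ hst with h | h | h | h | ⟨p, hp, h, hpd⟩
    · exact inf_le_left.trans (hs h)
    · exact inf_le_right.trans (ht h)
    · exact (ha₁.2 (show g (s ⊓ t) ≤ d₁ by rwa [map_inf])).trans (le_sup_left.trans hle)
    · exact (ha₂.2 (show g (s ⊓ t) ≤ d₂ by rwa [map_inf])).trans (le_sup_right.trans hle)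
    · exact hN p ⟨hp, hpd⟩ _ (by rwa [map_inf])

theorem RelatesBounds.dual {K : A → A → Prop} {d : D} (h : g.RelatesBounds K d) :
    (LatticeHom.dual g).RelatesBounds (fun a b => K (ofDual b) (ofDual a)) (toDual d) := by
  obtain ⟨b, a, hb, ha, hK⟩ := h
  exact ⟨toDual a, toDual b, ha, hb, hK⟩

theorem RelatesBounds.of_dual {K : A → A → Prop} {d : D}
    (h : (LatticeHom.dual g).RelatesBounds (fun a b => K (ofDual b) (ofDual a)) (toDual d)) :
    g.RelatesBounds K d := by
  obtain ⟨b, a, hb, ha, hK⟩ := h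
  exact ⟨ofDual a, ofDual b, ha, hb, hK⟩

theorem RelatesBounds.inf {X : Set A} (hX : LatticeGenerates X)
    {P : Set D} (hP : P.Finite) (hdean : DeanCondition P) (hXP : ∀ x ∈ X, g x ∈ P)
    {K : A → A → Prop}
    (hK : ∀ a b c d, K a b → K c d → K (a ⊓ c) (b ⊓ d)) (hKP : ∀ p ∈ P, g.RelatesBounds K p)
    {d₁ d₂ : D} (h₁ : g.RelatesBounds K d₁) (h₂ : g.RelatesBounds K d₂) :
    g.RelatesBounds K (d₁ ⊓ d₂) :=
  .of_dual <| RelatesBounds.sup (g := LatticeHom.dual g) hX.dual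
    (P := ofDual ⁻¹' P) hP hdean.dual hXP
    (K := fun a b => K (ofDual b) (ofDual a)) (fun _ _ _ _ h h' => hK _ _ _ _ h h')
    (fun p hp => (hKP (ofDual p) hp).dual) h₁.dual h₂.dual

/-- Under Dean's condition a relation compatible with the operations relates each element to the
greatest element of its class as soon as it does so on generators and relates finitely many bounds. -/
theorem rel_isGreatest {X : Set A} (hX : LatticeGenerates X) {P : Set D} (hP : P.Finite)
    (hdean : DeanCondition P) (hXP : ∀ x ∈ X, g x ∈ P) {K : A → A → Prop}
    (hsup : ∀ a b c d, K a b → K c d → K (a ⊔ c) (b ⊔ d))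
    (hinf : ∀ a b c d, K a b → K c d → K (a ⊓ c) (b ⊓ d))
    (hKP : ∀ p ∈ P, g.RelatesBounds K p)
    (hKX : ∀ x ∈ X, ∃ a, IsGreatest {y : A | g y ≤ g x} a ∧ K x a) (w : A) :
    ∃ a, IsGreatest {y : A | g y ≤ g w} a ∧ K w a := by
  have hrel : ∀ w, g.RelatesBounds K (g w) := by
    refine hX {w | g.RelatesBounds K (g w)} (fun x hx => hKP _ (hXP x hx)) ?_ ?_
    · intro s hs t ht
      rw [Set.mem_ofPred_eq, map_sup]
      exact RelatesBounds.sup hX hP hdean hXP hsup hKP hs ht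
    · intro s hs t ht
      rw [Set.mem_ofPred_eq, map_inf]
      exact RelatesBounds.inf hX hP hdean hXP hinf hKP hs ht
  refine hX {w | ∃ a, IsGreatest {y : A | g y ≤ g w} a ∧ K w a} hKX ?_ ?_ w
  · rintro s ⟨a, ha, hKa⟩ t ⟨b, hb, hKb⟩
    obtain ⟨b', a', hb', ha', hK'⟩ := hrel (s ⊔ t)
    refine ⟨a', ha', ?_⟩
    -- The join of the greatest elements over `s` and `t` may fall short of the greatest over `s ⊔
    -- t`. Joining with `(b', a')` raises the right entry to `a'`, and the left entry absorbs `b' ≤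
    -- s ⊔ t`.
    have h := hsup _ _ _ _ (hsup _ _ _ _ hKa hKb) hK'
    have ha1 : g a ≤ g s := ha.1
    have hb1 : g b ≤ g t := hb.1
    rwa [sup_eq_left.2 (hb'.2 (le_refl (g (s ⊔ t)))), sup_eq_right.2 (sup_le
      (ha'.2 (ha1.trans (OrderHomClass.mono g le_sup_left)))
      (ha'.2 (hb1.trans (OrderHomClass.mono g le_sup_right))))] at h
  · rintro s ⟨a, ha, hKa⟩ t ⟨b, hb, hKb⟩
    refine ⟨a ⊓ b, ⟨?_, fun y hy => ?_⟩, hinf _ _ _ _ hKa hKb⟩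
    · rw [Set.mem_ofPred_eq, map_inf, map_inf]
      exact inf_le_inf ha.1 hb.1
    · have hy' : g y ≤ g s ⊓ g t := by rw [← map_inf]; exact hy
      exact le_inf (ha.2 (hy'.trans inf_le_left)) (hb.2 (hy'.trans inf_le_right))

/-- Under Dean's condition the kernel of a bounded epimorphism is finitely generated as a
sublattice of the square. -/
theorem exists_finite_latticeClosure_eq_ker (hg : Function.Surjective g) {X : Set A}
    (hX : LatticeGenerates X) (hfin : X.Finite) {P : Set D} (hP : P.Finite)
    (hdean : DeanCondition P) (hlow : g.IsLowerBounded) (hup : g.IsUpperBounded) :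
    ∃ G : Set (A × A), G.Finite ∧ latticeClosure G = {p : A × A | g p.1 = g p.2} := by
  have hlow' : ∀ d, ∃ b, IsLeast {x : A | d ≤ g x} b := fun d => by
    obtain ⟨x, rfl⟩ := hg d; exact hlow.exists_isLeast le_rfl
  have hup' : ∀ d, ∃ a, IsGreatest {x : A | g x ≤ d} a := fun d => by
    obtain ⟨x, rfl⟩ := hg d; exact hup.exists_isGreatest le_rfl
  choose β hβ using hlow'
  choose α hα using hup'
  have hgβ : ∀ d, g (β d) = d := fun d => by
    refine le_antisymm ?_ (hβ d).1
    obtain ⟨x, rfl⟩ := hg d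
    exact OrderHomClass.mono g ((hβ (g x)).2 (le_refl (g x)))
  have hgα : ∀ d, g (α d) = d := fun d => by
    refine le_antisymm (hα d).1 ?_
    obtain ⟨x, rfl⟩ := hg d
    exact OrderHomClass.mono g ((hα (g x)).2 (le_refl (g x)))
  set Q : Set D := g '' X ∪ P
  have hQfin : Q.Finite := (hfin.image _).union hP
  -- The first family serves the induction on bounds, the second the generators. Swaps are added
  -- afterwards because a sublattice need not be symmetric.
  set H : Set (A × A) := (fun p => (β p, α p)) '' Q ∪ (fun x => (x, α (g x))) '' X
  have hHfin : H.Finite := (hQfin.image _).union (hfin.image _)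
  have hHker : ∀ p ∈ H, g p.1 = g p.2 := by
    rintro _ (⟨p, -, rfl⟩ | ⟨x, -, rfl⟩)
    · simp only [hgβ, hgα]
    · simp only [hgα]
  refine ⟨H ∪ Prod.swap '' H, hHfin.union (hHfin.image _),
    subset_antisymm (latticeClosure_min ?_ ⟨?_, ?_⟩) ?_⟩
  · rintro _ (hp | ⟨p, hp, rfl⟩)
    exacts [hHker _ hp, (hHker _ hp).symm]
  · rintro ⟨a, b⟩ (hab : g a = g b) ⟨c, d⟩ (hcd : g c = g d)
    simp only [Set.mem_ofPred_eq, Prod.mk_sup_mk, map_sup, hab, hcd]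
  · rintro ⟨a, b⟩ (hab : g a = g b) ⟨c, d⟩ (hcd : g c = g d)
    simp only [Set.mem_ofPred_eq, Prod.mk_inf_mk, map_inf, hab, hcd]
  set C := latticeClosure (H ∪ Prod.swap '' H)
  have hsub : H ∪ Prod.swap '' H ⊆ C := subset_latticeClosure
  have hlat : IsSublattice C := isSublattice_latticeClosure
  have hQX : ∀ x ∈ X, g x ∈ Q := fun x hx => .inl ⟨x, hx, rfl⟩
  have hQdean : DeanCondition Q := hdean.mono Set.subset_union_right
  have hleft : ∀ w, (w, α (g w)) ∈ C := fun w => by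
    obtain ⟨a, ha, h⟩ := rel_isGreatest hX hQfin hQdean hQX (K := fun a b => (a, b) ∈ C)
      (fun a b c d h h' => hlat.supClosed h h') (fun a b c d h h' => hlat.infClosed h h')
      (fun p hp => ⟨β p, α p, hβ p, hα p, hsub (.inl (.inl ⟨p, hp, rfl⟩))⟩)
      (fun x hx => ⟨α (g x), hα _, hsub (.inl (.inr ⟨x, hx, rfl⟩))⟩) w
    rwa [ha.unique (hα _)] at h
  have hright : ∀ w, (α (g w), w) ∈ C := fun w => by
    obtain ⟨a, ha, h⟩ := rel_isGreatest hX hQfin hQdean hQX (K := fun a b => (b, a) ∈ C)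
      (fun a b c d h h' => hlat.supClosed h h') (fun a b c d h h' => hlat.infClosed h h')
      (fun p hp => ⟨β p, α p, hβ p, hα p, hsub (.inr ⟨_, .inl ⟨p, hp, rfl⟩, rfl⟩)⟩)
      (fun x hx => ⟨α (g x), hα _, hsub (.inr ⟨_, .inr ⟨x, hx, rfl⟩, rfl⟩)⟩) w
    rwa [ha.unique (hα _)] at h
  have hleα : ∀ w, w ≤ α (g w) := fun w => (hα (g w)).2 (le_refl (g w))
  rintro ⟨x, y⟩ (hxy : g x = g y)
  have h := hlat.infClosed (hleft x) (hright y)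
  rwa [Prod.mk_inf_mk, hxy, inf_eq_left.2 (hxy ▸ hleα x), inf_eq_right.2 (hleα y)] at h

end LatticeHom

end Bounded

/-! ### Interval doubling and Dean's condition -/

namespace FreeLattice

variable {X D : Type*} [Lattice D]

theorem latticeGenerates_range_var :
    LatticeGenerates (Set.range fun x : X => mk (LatTerm.var x)) := by
  intro S hX hsup hinf a
  obtain ⟨t, rfl⟩ := mk_surjective a
  induction t with
  | var x => exact hX ⟨x, rfl⟩
  | join s t ihs iht => exact hsup _ ihs _ iht
  | meet s t ihs iht => exact hinf _ ihs _ iht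

/-- For the doubling of the interval `[d, e]` in `D`: whether the value of a term in the doubled
lattice lies in the upper part. -/
def InUpper (g : LatticeHom (FreeLattice X) D) (d e : D) : LatTerm X → Prop
  | .var x => d ≤ g (mk (.var x))
  | .join s t => InUpper g d e s ∨ InUpper g d e t ∨
      (d ≤ g (mk (.join s t)) ∧ ¬ g (mk (.join s t)) ≤ e)
  | .meet s t => InUpper g d e s ∧ InUpper g d e t

theorem InUpper.le {g : LatticeHom (FreeLattice X) D} {d e : D} {t : LatTerm X}
    (h : InUpper g d e t) : d ≤ g (mk t) := by
  induction t with
  | var x => exact h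
  | join s t ihs iht =>
    rcases h with h | h | h
    · exact (ihs h).trans (OrderHomClass.mono g (LatTerm.Le.left_le_join s t))
    · exact (iht h).trans (OrderHomClass.mono g (LatTerm.Le.right_le_join s t))
    · exact h.1
  | meet s t ihs iht =>
    rw [mk_meet, map_inf]
    exact le_inf (ihs h.1) (iht h.2)

/-- Only elements of `[d, e]` have two copies; an element above `d` but outside the interval lies in
the upper part whichever term represents it. -/
theorem inUpper_of_not_le {g : LatticeHom (FreeLattice X) D} {d e : D} {t : LatTerm X}
    (h : d ≤ g (mk t)) (he : ¬ g (mk t) ≤ e) : InUpper g d e t := by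
  induction t with
  | var x => exact h
  | join s t ihs iht => exact .inr (.inr ⟨h, he⟩)
  | meet s t ihs iht =>
    rw [mk_meet, map_inf] at h he
    exact ⟨ihs (h.trans inf_le_left) fun h' => he (inf_le_left.trans h'),
      iht (h.trans inf_le_right) fun h' => he (inf_le_right.trans h')⟩

/-- This makes membership in the upper part independent of the representing term. -/
theorem InUpper.mono {g : LatticeHom (FreeLattice X) D} {d e : D} {s t : LatTerm X}
    (hst : s ≤ t) (h : InUpper g d e s) : InUpper g d e t := by
  induction (hst : LatTerm.Le s t) with
  | refl => exact h
  | trans h₁ h₂ ih₁ ih₂ => exact ih₂ (ih₁ h)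
  | left_le_join => exact .inl h
  | right_le_join => exact .inr (.inl h)
  | join_le h₁ h₂ ih₁ ih₂ =>
    rcases h with h | h | h
    · exact ih₁ h
    · exact ih₂ h
    · have := OrderHomClass.mono g (mk_le_mk.2 (LatTerm.Le.join_le h₁ h₂))
      exact inUpper_of_not_le (h.1.trans this) fun h' => h.2 (this.trans h')
  | meet_le_left => exact h.1
  | meet_le_right => exact h.2
  | le_meet h₁ h₂ ih₁ ih₂ => exact ⟨ih₁ h, ih₂ h⟩

/-- `InUpper` on elements of the free lattice. -/
def MemUpper (g : LatticeHom (FreeLattice X) D) (d e : D) : FreeLattice X → Prop :=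
  Quotient.lift (InUpper g d e) fun _ _ h => propext ⟨.mono h.1, .mono h.2⟩

theorem memUpper_sup {g : LatticeHom (FreeLattice X) D} {d e : D} (a b : FreeLattice X) :
    MemUpper g d e (a ⊔ b) ↔
      MemUpper g d e a ∨ MemUpper g d e b ∨ (d ≤ g (a ⊔ b) ∧ ¬ g (a ⊔ b) ≤ e) := by
  obtain ⟨s, rfl⟩ := mk_surjective a
  obtain ⟨t, rfl⟩ := mk_surjective b
  exact Iff.rfl

theorem memUpper_inf {g : LatticeHom (FreeLattice X) D} {d e : D} (a b : FreeLattice X) :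
    MemUpper g d e (a ⊓ b) ↔ MemUpper g d e a ∧ MemUpper g d e b := by
  obtain ⟨s, rfl⟩ := mk_surjective a
  obtain ⟨t, rfl⟩ := mk_surjective b
  exact Iff.rfl

theorem MemUpper.le {g : LatticeHom (FreeLattice X) D} {d e : D} {a : FreeLattice X}
    (h : MemUpper g d e a) : d ≤ g a := by
  obtain ⟨s, rfl⟩ := mk_surjective a
  exact InUpper.le h

theorem memUpper_of_not_le {g : LatticeHom (FreeLattice X) D} {d e : D} {a : FreeLattice X}
    (h : d ≤ g a) (he : ¬ g a ≤ e) : MemUpper g d e a := by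
  obtain ⟨s, rfl⟩ := mk_surjective a
  exact inUpper_of_not_le h he

/-- The kernel of the homomorphism to the doubling of `[d, e]` that lifts `g`. -/
def upperCon (g : LatticeHom (FreeLattice X) D) (d e : D) : LatticeCon (FreeLattice X) where
  r a b := g a = g b ∧ (MemUpper g d e a ↔ MemUpper g d e b)
  iseqv :=
    { refl := fun _ => ⟨rfl, Iff.rfl⟩
      symm := fun h => ⟨h.1.symm, h.2.symm⟩
      trans := fun h₁ h₂ => ⟨h₁.1.trans h₂.1, h₁.2.trans h₂.2⟩ }
  inf h₁ h₂ := ⟨by rw [map_inf, map_inf, h₁.1, h₂.1],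
    by rw [memUpper_inf, memUpper_inf, h₁.2, h₂.2]⟩
  sup h₁ h₂ := ⟨by rw [map_sup, map_sup, h₁.1, h₂.1],
    by rw [memUpper_sup, memUpper_sup, h₁.2, h₂.2, map_sup, map_sup, h₁.1, h₂.1]⟩

/-- A lattice presented by relations `R` satisfies Dean's condition relative to the elements
occurring in `R`. -/
theorem deanCondition_of_presentation {g : LatticeHom (FreeLattice X) D}
    (hg : Function.Surjective g) {R : Set (FreeLattice X × FreeLattice X)}
    (hR : ∀ p ∈ R, g p.1 = g p.2)
    (hker : ∀ c : LatticeCon (FreeLattice X), (∀ p ∈ R, c.r p.1 p.2) →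
      ∀ a b, g a = g b → c.r a b) :
    DeanCondition ((fun p => g p.1) '' R) := by
  intro a b c d habcd
  obtain ⟨a, rfl⟩ := hg a
  obtain ⟨b, rfl⟩ := hg b
  obtain ⟨c, rfl⟩ := hg c
  obtain ⟨d, rfl⟩ := hg d
  by_contra! hcon
  obtain ⟨h₁, h₂, h₃, h₄, h₅⟩ := hcon
  -- No relation side has its value in the doubled interval, so the value alone decides its
  -- membership in the upper part.
  have hcon : ∀ p ∈ R, (upperCon g (g a ⊓ g b) (g c ⊔ g d)).r p.1 p.2 := by
    intro p hp
    have hiff : ∀ x, g x = g p.1 →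
        (MemUpper g (g a ⊓ g b) (g c ⊔ g d) x ↔ g a ⊓ g b ≤ g x) := fun x hx =>
      ⟨MemUpper.le, fun h => memUpper_of_not_le h (hx ▸ h₅ _ ⟨p, hp, rfl⟩ (hx ▸ h))⟩
    exact ⟨hR p hp, by rw [hiff _ rfl, hiff _ (hR p hp).symm, hR p hp]⟩
  have hab : MemUpper g (g a ⊓ g b) (g c ⊔ g d) (a ⊓ b) := (memUpper_inf _ _).2
    ⟨memUpper_of_not_le inf_le_left h₁, memUpper_of_not_le inf_le_right h₂⟩
  -- The upper part contains `a ⊓ b`, hence also its join with `c ⊔ d`. That join equals `c ⊔ d` in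
  -- `D`, so `c ⊔ d` would be upper too, which every clause for joins excludes.
  have habcd' : g ((a ⊓ b) ⊔ (c ⊔ d)) = g (c ⊔ d) := by
    rw [map_sup, map_inf, map_sup, sup_eq_right.2 habcd]
  have hcd := (hker _ hcon _ _ habcd').2.1 ((memUpper_sup _ _).2 (.inl hab))
  rcases (memUpper_sup _ _).1 hcd with h | h | h
  · exact h₃ h.le
  · exact h₄ h.le
  · exact h.2 (map_sup g c d).le

/-! ### Whitman's condition, prime variables and maps into free lattices -/

/-- Whitman's condition. -/
theorem deanCondition_empty : DeanCondition (∅ : Set (FreeLattice X)) := by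
  have h := deanCondition_of_presentation (g := LatticeHom.id (FreeLattice X))
    Function.surjective_id (R := ∅) (fun _ h => h.elim)
    (fun c _ a b h => (show a = b from h) ▸ c.iseqv.refl a)
  rwa [Set.image_empty] at h

theorem var_supPrime (x : X) (s t : FreeLattice X) (h : mk (.var x) ≤ s ⊔ t) :
    mk (.var x) ≤ s ∨ mk (.var x) ≤ t := by
  -- `Prop` serves as the two-element lattice; `f` is the indicator of the filter above the variable
  -- `x`.
  obtain ⟨f, hf, -⟩ := existsUnique_hom fun y : X => y = x
  have key : ∀ w, f w → mk (.var x) ≤ w := by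
    refine latticeGenerates_range_var {w | f w → mk (.var x) ≤ w} ?_ ?_ ?_
    · rintro _ ⟨y, rfl⟩ hy
      rw [hf] at hy
      rw [hy]
    · intro a ha b hb hab
      rw [map_sup] at hab
      exact hab.elim (fun h => (ha h).trans le_sup_left) fun h => (hb h).trans le_sup_right
    · intro a ha b hb hab
      rw [map_inf] at hab
      exact le_inf (ha hab.1) (hb hab.2)
  have hst : f (s ⊔ t) := OrderHomClass.mono f h (by rw [hf])
  rw [map_sup] at hst
  exact hst.imp (key s) (key t)

theorem var_infPrime (x : X) (s t : FreeLattice X) (h : s ⊓ t ≤ mk (.var x)) :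
    s ≤ mk (.var x) ∨ t ≤ mk (.var x) := by
  obtain ⟨f, hf, -⟩ := existsUnique_hom fun y : X => y ≠ x
  have key : ∀ w, ¬ f w → w ≤ mk (.var x) := by
    refine latticeGenerates_range_var {w | ¬ f w → w ≤ mk (.var x)} ?_ ?_ ?_
    · rintro _ ⟨y, rfl⟩ hy
      rw [hf, not_not] at hy
      rw [hy]
    · intro a ha b hb hab
      rw [map_sup] at hab
      exact sup_le (ha fun h => hab (.inl h)) (hb fun h => hab (.inr h))
    · intro a ha b hb hab
      rw [map_inf] at hab
      by_cases h : f a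
      · exact inf_le_right.trans (hb fun h' => hab ⟨h, h'⟩)
      · exact inf_le_left.trans (ha h)
  have hst : ¬ f (s ⊓ t) := fun h' => by
    have := OrderHomClass.mono f h h'
    rw [hf] at this
    exact this rfl
  rw [map_inf] at hst
  exact (not_and_or.1 hst).imp (key s) (key t)

theorem isLowerBounded_to_free {A : Type*} [Lattice A] {G : Set A} (hG : LatticeGenerates G)
    (hfin : G.Finite) (h : LatticeHom A (FreeLattice X)) : h.IsLowerBounded :=
  h.isLowerBounded_of_supPrime hG hfin latticeGenerates_range_var deanCondition_empty <| by
    rintro _ ⟨x, rfl⟩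
    exact var_supPrime x

theorem isUpperBounded_to_free {A : Type*} [Lattice A] {G : Set A} (hG : LatticeGenerates G)
    (hfin : G.Finite) (h : LatticeHom A (FreeLattice X)) : h.IsUpperBounded := by
  refine .of_dual ((LatticeHom.dual h).isLowerBounded_of_supPrime hG.dual hfin
    latticeGenerates_range_var.dual deanCondition_empty.dual ?_)
  rintro _ ⟨x, rfl⟩
  exact var_infPrime x

/-! ### Independence of the free cover -/

theorem exists_lift {Y : Type*} {f : LatticeHom (FreeLattice Y) D} (hf : Function.Surjective f)
    (g : LatticeHom (FreeLattice X) D) :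
    ∃ h : LatticeHom (FreeLattice X) (FreeLattice Y), ∀ w, f (h w) = g w := by
  choose v hv using fun x : X => hf (g (mk (.var x)))
  obtain ⟨h, hh, -⟩ := existsUnique_hom v
  refine ⟨h, latticeGenerates_range_var {w | f (h w) = g w} ?_ ?_ ?_⟩
  · rintro _ ⟨x, rfl⟩
    simp only [Set.mem_ofPred_eq, hh, hv]
  · intro a (ha : _ = _) b (hb : _ = _)
    simp only [Set.mem_ofPred_eq, map_sup, ha, hb]
  · intro a (ha : _ = _) b (hb : _ = _)
    simp only [Set.mem_ofPred_eq, map_inf, ha, hb]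

/-- Lower boundedness does not depend on the choice of a finitely generated free cover. -/
theorem isLowerBounded_of_surjective [Finite X] {Y : Type*} {f : LatticeHom (FreeLattice Y) D}
    (hf : Function.Surjective f) (hlow : f.IsLowerBounded) (g : LatticeHom (FreeLattice X) D) :
    g.IsLowerBounded := by
  obtain ⟨h, hh⟩ := exists_lift hf g
  intro d
  obtain ⟨y, rfl⟩ := hf d
  obtain ⟨b, hb⟩ := hlow.exists_isLeast (le_refl (f y))
  -- Since `g` factors as `f` after `h`, the least preimage `b` under `f` reduces the question to
  -- `h`, a map between free lattices.
  have hset : {x | f y ≤ g x} = {x | b ≤ h x} := by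
    ext x
    rw [Set.mem_ofPred_eq, ← hh]
    exact ⟨fun h' => hb.2 h', fun h' => le_trans hb.1 (OrderHomClass.mono f h')⟩
  rw [hset]
  exact isLowerBounded_to_free latticeGenerates_range_var (Set.finite_range _) h b

theorem isUpperBounded_of_surjective [Finite X] {Y : Type*} {f : LatticeHom (FreeLattice Y) D}
    (hf : Function.Surjective f) (hup : f.IsUpperBounded) (g : LatticeHom (FreeLattice X) D) :
    g.IsUpperBounded := by
  obtain ⟨h, hh⟩ := exists_lift hf g
  intro d
  obtain ⟨y, rfl⟩ := hf d
  obtain ⟨b, hb⟩ := hup.exists_isGreatest (le_refl (f y))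
  have hset : {x | g x ≤ f y} = {x | h x ≤ b} := by
    ext x
    rw [Set.mem_ofPred_eq, ← hh]
    exact ⟨fun h' => hb.2 h', fun h' => le_trans (OrderHomClass.mono f h') hb.1⟩
  rw [hset]
  exact isUpperBounded_to_free latticeGenerates_range_var (Set.finite_range _) h b

theorem exists_surjective_fin [Finite X] {g : LatticeHom (FreeLattice X) D}
    (hg : Function.Surjective g) :
    ∃ (n : ℕ) (f : LatticeHom (FreeLattice (Fin n)) D), Function.Surjective f := by
  obtain ⟨n, ⟨e⟩⟩ := Finite.exists_equiv_fin X
  obtain ⟨f, hf, -⟩ := existsUnique_hom fun i : Fin n => g (mk (.var (e.symm i)))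
  refine ⟨n, f, fun d => ?_⟩
  obtain ⟨w, rfl⟩ := hg d
  refine latticeGenerates_range_var {w | ∃ z, f z = g w} ?_ ?_ ?_ w
  · rintro _ ⟨x, rfl⟩
    exact ⟨mk (.var (e x)), by rw [hf, e.symm_apply_apply]⟩
  · rintro a ⟨z, hz⟩ b ⟨y, hy⟩
    exact ⟨z ⊔ y, by rw [map_sup, map_sup, hz, hy]⟩
  · rintro a ⟨z, hz⟩ b ⟨y, hy⟩
    exact ⟨z ⊓ y, by rw [map_inf, map_inf, hz, hy]⟩

theorem isBoundedLattice_iff [Finite X] {g : LatticeHom (FreeLattice X) D}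
    (hg : Function.Surjective g) :
    IsBoundedLattice D ↔ g.IsLowerBounded ∧ g.IsUpperBounded := by
  constructor
  · rintro ⟨⟨n, f, hf, hlow⟩, m, f', hf', hup⟩
    exact ⟨isLowerBounded_of_surjective hf hlow g, isUpperBounded_of_surjective hf' hup g⟩
  · rintro ⟨hlow, hup⟩
    obtain ⟨n, f, hf⟩ := exists_surjective_fin hg
    exact ⟨⟨n, f, hf, isLowerBounded_of_surjective hg hlow f⟩,
      n, f, hf, isUpperBounded_of_surjective hg hup f⟩

/-! ### Finitely generated kernels -/

/-- A homomorphism from a free lattice is bounded if its kernel is a finitely generated sublattice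
of the square. -/
theorem isBounded_of_finite_latticeClosure_eq_ker {g : LatticeHom (FreeLattice X) D}
    (hg : Function.Surjective g) {G : Set (FreeLattice X × FreeLattice X)} (hG : G.Finite)
    (hker : latticeClosure G = {p | g p.1 = g p.2}) : g.IsLowerBounded ∧ g.IsUpperBounded := by
  let C : Sublattice (FreeLattice X × FreeLattice X) :=
    ⟨latticeClosure G, isSublattice_latticeClosure.supClosed,
      isSublattice_latticeClosure.infClosed⟩
  have hmem : ∀ a b, g a = g b → (a, b) ∈ C := fun a b h => by
    change (a, b) ∈ latticeClosure G
    rw [hker]; exact h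
  have hC : ∀ c : C, g c.1.1 = g c.1.2 := fun c => by
    have : c.1 ∈ latticeClosure G := c.2
    rw [hker] at this; exact this
  have hgen : LatticeGenerates ((↑) ⁻¹' G : Set C) := by
    intro S hS hsup hinf a
    have : latticeClosure G ⊆ {p | ∃ h : p ∈ C, (⟨p, h⟩ : C) ∈ S} := by
      refine latticeClosure_min (fun p hp => ⟨subset_latticeClosure hp, hS hp⟩) ⟨?_, ?_⟩
      · rintro p ⟨hp, hp'⟩ q ⟨hq, hq'⟩
        exact ⟨_, hsup _ hp' _ hq'⟩
      · rintro p ⟨hp, hp'⟩ q ⟨hq, hq'⟩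
        exact ⟨_, hinf _ hp' _ hq'⟩
    exact (this a.2).2
  have hfin : ((↑) ⁻¹' G : Set C).Finite := hG.preimage Subtype.val_injective.injOn
  -- Bounding the second coordinate by `b` yields an extremal kernel pair; its first coordinate is
  -- the required bound for `g`.
  let π : LatticeHom C (FreeLattice X) :=
    { toFun := fun c => c.1.2
      map_sup' := fun _ _ => rfl
      map_inf' := fun _ _ => rfl }
  constructor
  · intro d
    obtain ⟨b, rfl⟩ := hg d
    obtain ⟨c, hc⟩ := (isLowerBounded_to_free hgen hfin π).exists_isLeast
      (x := ⟨(b, b), hmem b b rfl⟩) (le_refl b)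
    refine .inr ⟨c.1.1, ?_, fun w (hw : g b ≤ g w) => ?_⟩
    · rw [Set.mem_ofPred_eq, hC c]
      exact OrderHomClass.mono g hc.1
    -- The pair `(w, w ⊔ b)` lies in the kernel and has second entry above `b`, so the least such
    -- pair lies below it and its first entry is below `w`.
    · have hw' : g w = g (w ⊔ b) := by rw [map_sup, sup_eq_left.2 hw]
      exact (show c ≤ ⟨(w, w ⊔ b), hmem _ _ hw'⟩ from
        hc.2 (show b ≤ w ⊔ b from le_sup_right)).1
  · intro d
    obtain ⟨b, rfl⟩ := hg d
    obtain ⟨c, hc⟩ := (isUpperBounded_to_free hgen hfin π).exists_isGreatest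
      (x := ⟨(b, b), hmem b b rfl⟩) (le_refl b)
    refine .inr ⟨c.1.1, ?_, fun w (hw : g w ≤ g b) => ?_⟩
    · rw [Set.mem_ofPred_eq, hC c]
      exact OrderHomClass.mono g hc.1
    · have hw' : g w = g (w ⊓ b) := by rw [map_inf, inf_eq_left.2 hw]
      exact (show ⟨(w, w ⊓ b), hmem _ _ hw'⟩ ≤ c from
        hc.2 (show w ⊓ b ≤ b from inf_le_right)).1

end FreeLattice

/-! ### Congruence classes and the equivalence -/

namespace LatticeHom

variable {A D : Type*} [Lattice A] [Lattice D] {g : LatticeHom A D}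

/-- Meeting an element whose image is at least `g u` with a member of the class of `u` lands back in
that class. -/
theorem isLeast_class_iff {u a : A} :
    IsLeast {w | g u = g w} a ↔ IsLeast {w | g u ≤ g w} a := by
  constructor
  · refine fun h => ⟨(show g u = g a from h.1).le, fun w (hw : g u ≤ g w) => ?_⟩
    have ha : g u = g a := h.1
    have : g u = g (w ⊓ a) := by rw [map_inf, ← ha, inf_eq_right.2 hw]
    exact (h.2 this).trans inf_le_left
  · refine fun h => ⟨le_antisymm h.1 ?_, fun w hw => h.2 (show g u = g w from hw).le⟩
    exact OrderHomClass.mono g (h.2 (le_refl (g u)))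

theorem isGreatest_class_iff {u a : A} :
    IsGreatest {w | g u = g w} a ↔ IsGreatest {w | g w ≤ g u} a := by
  constructor
  · refine fun h => ⟨(show g u = g a from h.1).ge, fun w (hw : g w ≤ g u) => ?_⟩
    have ha : g u = g a := h.1
    have : g u = g (w ⊔ a) := by rw [map_sup, ← ha, sup_eq_right.2 hw]
    exact le_sup_left.trans (h.2 this)
  · refine fun h => ⟨le_antisymm ?_ h.1, fun w hw => h.2 (show g u = g w from hw).ge⟩
    exact OrderHomClass.mono g (h.2 (le_refl (g u)))

end LatticeHom

/-- The quotient homomorphism of a lattice congruence. -/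
def LatticeCon.quotHom {A : Type*} [Lattice A] (ρ : LatticeCon A) : LatticeHom A ρ.Quot where
  toFun := ρ.toQuot
  map_sup' := ρ.toQuot_sup
  map_inf' := ρ.toQuot_inf

theorem LatticeCon.quotHom_eq_iff {A : Type*} [Lattice A] (ρ : LatticeCon A) {a b : A} :
    ρ.quotHom a = ρ.quotHom b ↔ ρ.r a b :=
  Quotient.eq (r := ρ.toSetoid)

theorem LatticeGenerates.image {A D : Type*} [Lattice A] [Lattice D] {X : Set A}
    (hX : LatticeGenerates X) {g : LatticeHom A D} (hg : Function.Surjective g) :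
    LatticeGenerates (g '' X) := by
  intro S hS hsup hinf d
  obtain ⟨a, rfl⟩ := hg d
  refine hX (g ⁻¹' S) (Set.image_subset_iff.1 hS) ?_ ?_ a
  · intro a ha b hb
    rw [Set.mem_preimage, map_sup]
    exact hsup _ ha _ hb
  · intro a ha b hb
    rw [Set.mem_preimage, map_inf]
    exact hinf _ ha _ hb

theorem LatTerm.self_mem_subterms {X : Type*} (t : LatTerm X) : t ∈ t.subterms := by
  cases t
  · exact rfl
  · exact .inl rfl
  · exact .inl rfl

theorem corollary1p5 {X : Type*} [Finite X] (R : Set (LatTerm X × LatTerm X)) (hR : R.Finite)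
    (ρ : LatticeCon (FreeLattice X))
    (hρ : ρ = LatticeCon.generate
      ((fun p : LatTerm X × LatTerm X => (FreeLattice.mk p.1, FreeLattice.mk p.2)) '' R)) :
    List.TFAE [
      IsBoundedLattice ρ.Quot,
      ∃ G : Set (FreeLattice X × FreeLattice X), G.Finite ∧
        latticeClosure G = {p : FreeLattice X × FreeLattice X | ρ.r p.1 p.2},
      ∀ u : LatTerm X,
        ((∃ x : X, u = LatTerm.var x) ∨
          ∃ p ∈ R, u ∈ LatTerm.subterms p.1 ∨ u ∈ LatTerm.subterms p.2) →
        (∃ a, IsLeast {w : FreeLattice X | ρ.r (FreeLattice.mk u) w} a) ∧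
          ∃ b, IsGreatest {w : FreeLattice X | ρ.r (FreeLattice.mk u) w} b] := by
  have hg : Function.Surjective ρ.quotHom := ρ.toQuot_surjective
  have hX := FreeLattice.latticeGenerates_range_var (X := X)
  have hfin := Set.finite_range fun x : X => FreeLattice.mk (LatTerm.var x)
  set S := (fun p : LatTerm X × LatTerm X => (FreeLattice.mk p.1, FreeLattice.mk p.2)) '' R
  have hP : ((fun p => ρ.quotHom p.1) '' S).Finite := (hR.image _).image _
  have hdean : DeanCondition ((fun p => ρ.quotHom p.1) '' S) := by
    refine FreeLattice.deanCondition_of_presentation hg (fun p hp => ρ.quotHom_eq_iff.2 ?_) ?_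
    · rw [hρ]
      exact fun c hc => hc p hp
    · intro c hc a b hab
      have hab := ρ.quotHom_eq_iff.1 hab
      rw [hρ] at hab
      exact hab c hc
  simp only [← ρ.quotHom_eq_iff, FreeLattice.isBoundedLattice_iff hg,
    LatticeHom.isLeast_class_iff, LatticeHom.isGreatest_class_iff]
  tfae_have 1 → 2 := fun h =>
    LatticeHom.exists_finite_latticeClosure_eq_ker hg hX hfin hP hdean h.1 h.2
  tfae_have 2 → 1 := fun ⟨G, hG, h⟩ =>
    FreeLattice.isBounded_of_finite_latticeClosure_eq_ker hg hG h
  tfae_have 1 → 3 := fun h u _ =>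
    ⟨h.1.exists_isLeast (le_refl (ρ.quotHom _)), h.2.exists_isGreatest (le_refl (ρ.quotHom _))⟩
  tfae_have 3 → 1 := by
    intro h
    have hvar := fun x : X => h (.var x) (.inl ⟨x, rfl⟩)
    -- The exceptional set consists of images of left sides, each a subterm of itself; the variables
    -- supply the generators.
    have hrel := fun p hp => h (Prod.fst p) (.inr ⟨p, hp, .inl p.1.self_mem_subterms⟩)
    constructor
    · refine ρ.quotHom.isLowerBounded_of_deanCondition hX hfin (hX.image hg) hP hdean ?_ ?_
      · rintro _ ⟨_, ⟨p, hp, rfl⟩, rfl⟩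
        exact .inr (hrel p hp).1
      · rintro _ ⟨_, ⟨x, rfl⟩, rfl⟩
        exact .inr (hvar x).1
    · refine .of_dual ((LatticeHom.dual ρ.quotHom).isLowerBounded_of_deanCondition hX.dual hfin
        (hX.image hg).dual hP hdean.dual ?_ ?_)
      · rintro _ ⟨_, ⟨p, hp, rfl⟩, rfl⟩
        exact .inr (hrel p hp).2
      · rintro _ ⟨_, ⟨x, rfl⟩, rfl⟩
        exact .inr (hvar x).2
  tfae_finish
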